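/- Let $p_n$ denote the $n$-th prime ($p_1=2$), and let $P_1=\{p_n : n\ge 1,\ n \text{ not prime}\}$ (so $n$ is $1$ or composite). Let $T_1$ be the set of all twin pairs $\{v,v+2\}$ of primes greater than $5$. Let $T_{1u}$ (the u-pairs) be the set of the pairs in $T_1$ with both elements in $P_1$, and let $T_{1b}=T_1\setminus T_{1u}$ (the b-pairs). For natural numbers $l\ge 13$, $s\ge 3$ with $s\le l$ put $$D(l,s)=\frac{d(l-s+1)+d(l-s+2)+\dots+d(l)}{s+2},$$ where $d(m)$ is the number of prime factors of $m$ counted with multiplicity, and let $T_{sr}$ (the strongly related twins) be the set of the pairs $\{v,v+2\}\in T_1$ with $D(v+2,3)=1$. Put $T_{(sr)u}=T_{sr}\cap T_{1u}$ and $T_{(sr)b}=T_{sr}\cap T_{1b}$. Then for each of the six classes $T=T_1,\ T_{1u},\ T_{1b},\ T_{sr},\ T_{(sr)u},\ T_{(sr)b}$, whether it is finite or infinite, the series of positive terms $$\sum_{\{v,v+2\}\in T}\left(\frac1v+\frac1{v+2}\right)$$ (where $v$ is the smaller element of the pair) is convergent; in particular, if $T$ is infinite and $v_1<v_2<\cdots$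 are the smaller elements of its pairs, then $\sum_{i=1}^\infty\left(\frac1{v_i}+\frac1{v_i+2}\right)$ converges. -/

import Mathlib

namespace TwinPairs

/-- The `n`-th prime `p_n` for `n ≥ 1`: `p_1 = 2`, `p_2 = 3`, `p_3 = 5`, ...
(`Nat.nth` counts from `0`; the value at `n = 0` is never used). -/
noncomputable def nthPrime (n : ℕ) : ℕ := Nat.nth Nat.Prime (n - 1)

/-- The set of origins of the principal Eratosthenes rays: the primes `p_n` whose
number `n ≥ 1` is not prime, that is, `n` is `1` or composite. -/
def origins : Set ℕ := {p | ∃ n : ℕ, 1 ≤ n ∧ ¬ n.Prime ∧ p = nthPrime n}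

/-- The collective divisibility coefficient
`D(l, s) = (d(l - s + 1) + ... + d(l)) / (s + 2)`, for `1 ≤ s ≤ l`. Here `d(m)` is the number of
prime factors of `m` counted with multiplicity: this is the `d` for which the twin pairs
with `D(v + 2, 3) = 1` are the pairs around `v + 1 = 2 * 3 * σ` with `σ` prime
(`{11, 13}, {17, 19}, {29, 31}, {41, 43}, {101, 103}, {137, 139}, ...`). -/
def collectiveDivisibility (l s : ℕ) : ℚ :=
  ((∑ m ∈ Finset.Icc (l + 1 - s) l, ArithmeticFunction.cardFactors m : ℕ) : ℚ) / ((s : ℚ) + 2)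

/-! Each class of twin pairs `{v, v + 2}` is given by the set of the smaller elements `v`. -/

/-- Twin pairs of primes greater than `5`. -/
def twins : Set ℕ := {v | 5 < v ∧ v.Prime ∧ (v + 2).Prime}

/-- The u-pairs: both elements are origins of principal rays. -/
def twinsU : Set ℕ := {v | v ∈ twins ∧ v ∈ origins ∧ v + 2 ∈ origins}

/-- The b-pairs: all the other twin pairs. -/
def twinsB : Set ℕ := twins \ twinsU

/-- The strongly related twins: `D(l, 3) = 1` for the triple `v, v + 1, v + 2 = l`. -/
def strongTwins : Set ℕ := {v | v ∈ twins ∧ collectiveDivisibility (v + 2) 3 = 1}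

/-- The strongly related u-pairs. -/
def strongTwinsU : Set ℕ := strongTwins ∩ twinsU

/-- The strongly related b-pairs. -/
def strongTwinsB : Set ℕ := strongTwins ∩ twinsB

end TwinPairs

/-! Every class is a subset of the twin pairs and the terms are positive, so all six claims follow
from Brun's theorem, proved here with Selberg's sieve.

Sieve the numbers `n * (n + 2)`, `n < N`, by the odd primes up to `R`. For odd squarefree `d` the
condition `d ∣ n * (n + 2)` selects `τ(d)` residue classes mod `d`, so the density is `τ(d) / d`
with an error of at most `d`. The sieve (`siftedSum_le_selberg`) leaves at most `N / S + R ^ 6`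
values, where `S` is at least the sum of `τ(l) / l` over odd squarefree `l ≤ R`. For `R = (2 * K) ^
2` that sum is at least `log (K + 1) ^ 2 / 32` (`log_sq_le_sum_oddSquarefree`). With `K = 2 ^ m`,
the twins in `[2 ^ (16 * m), 2 ^ (16 * (m + 1)))` contribute `O(1 / m ^ 2 + 2 ^ (-m))`, which is
summable over `m`. -/

/-! ### Selberg's upper bound sieve -/

namespace BoundingSieve

open Finset ArithmeticFunction
open scoped ArithmeticFunction.Moebius

variable (s : BoundingSieve) (R : ℕ)

/-- The sum `S` of the Selberg terms up to the level `R`. -/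
noncomputable def selbergMass : ℝ :=
  ∑ l ∈ s.prodPrimes.divisors with l ≤ R, s.selbergTerms l

/-- The optimal weights of the Selberg sieve, supported on the divisors of the product of the
primes that are at most `R`. -/
noncomputable def selbergWeight (d : ℕ) : ℝ :=
  if d ∣ s.prodPrimes then
    (μ d : ℝ) * (s.nu d)⁻¹ *
      (∑ l ∈ s.prodPrimes.divisors with l ≤ R, if d ∣ l then s.selbergTerms l else 0) /
        s.selbergMass R
  else 0

variable {s R}

theorem selbergTerms_nonneg_of_mem_divisors {l : ℕ} (hl : l ∈ s.prodPrimes.divisors) :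
    0 ≤ s.selbergTerms l :=
  (selbergTerms_pos (Nat.dvd_of_mem_divisors hl)).le

theorem selbergMass_pos (hR : 1 ≤ R) : 0 < s.selbergMass R := by
  refine sum_pos' (fun l hl => selbergTerms_nonneg_of_mem_divisors (mem_filter.1 hl).1)
    ⟨1, by simp [prodPrimes_ne_zero, hR], selbergTerms_pos (one_dvd _)⟩

theorem selbergWeight_one (hR : 1 ≤ R) : s.selbergWeight R 1 = 1 := by
  have h := (selbergMass_pos (s := s) hR).ne'
  have h1 : s.nu 1 = 1 := s.nu_mult.map_one
  simp only [selbergWeight, one_dvd, if_true, h1]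
  simp only [moebius_apply_one, Int.cast_one, inv_one, one_mul]
  exact div_self h

theorem selbergWeight_eq_zero_of_lt {d : ℕ} (hd : R < d) : s.selbergWeight R d = 0 := by
  unfold selbergWeight
  split_ifs with h
  · rw [sum_eq_zero, mul_zero, zero_div]
    intro l hl
    simp only [mem_filter, Nat.mem_divisors] at hl
    rw [if_neg]
    intro hdl
    have := Nat.le_of_dvd (Nat.pos_of_dvd_of_pos hl.1.1 (Nat.pos_of_ne_zero hl.1.2)) hdl
    omega
  · rfl

theorem abs_selbergWeight_le {d : ℕ} (hR : 1 ≤ R) (hd : d ∣ s.prodPrimes) :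
    |s.selbergWeight R d| ≤ (s.nu d)⁻¹ := by
  have hS := selbergMass_pos (s := s) hR
  have hnu := nu_pos_of_dvd_prodPrimes hd
  have h0 : 0 ≤ ∑ l ∈ s.prodPrimes.divisors with l ≤ R,
      if d ∣ l then s.selbergTerms l else 0 := by
    refine sum_nonneg fun l hl => ?_
    have := selbergTerms_nonneg_of_mem_divisors (mem_filter.1 hl).1
    split_ifs <;> simp [this]
  have h1 : (∑ l ∈ s.prodPrimes.divisors with l ≤ R,
      if d ∣ l then s.selbergTerms l else 0) ≤ s.selbergMass R := by
    refine sum_le_sum fun l hl => ?_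
    have := selbergTerms_nonneg_of_mem_divisors (mem_filter.1 hl).1
    split_ifs <;> simp [this]
  have hmu : |(μ d : ℝ)| ≤ 1 := by
    exact_mod_cast abs_moebius_le_one (n := d)
  rw [selbergWeight, if_pos hd, abs_div, abs_mul, abs_mul, abs_of_pos hS, abs_of_nonneg h0,
    abs_of_pos (inv_pos.2 hnu), div_le_iff₀ hS]
  have := inv_pos.2 hnu
  calc _ ≤ 1 * (s.nu d)⁻¹ * s.selbergMass R := by gcongr
    _ = _ := by ring

/-- Write `m = l * k` and `d = l * e` with `e ∣ k`. Coprimality of `l` and `k` pulls out `μ l`, and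
the sum of `μ e` over `e ∣ k` vanishes unless `k = 1`. -/
theorem sum_moebius_between {l m P : ℕ} (hP : P ≠ 0) (hm : Squarefree m) (hmP : m ∣ P) :
    (∑ d ∈ P.divisors, if l ∣ d ∧ d ∣ m then (μ d : ℝ) else 0) =
      if l = m then (μ l : ℝ) else 0 := by
  by_cases hlm : l ∣ m
  · obtain ⟨k, rfl⟩ := hlm
    have hl0 : l ≠ 0 := by rintro rfl; simp at hm
    have hk0 : k ≠ 0 := by rintro rfl; simp at hm
    have hcop : l.Coprime k := Nat.coprime_of_squarefree_mul hm
    have e : (∑ d ∈ P.divisors, if l ∣ d ∧ d ∣ l * k then (μ d : ℝ) else 0) =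
        ∑ e ∈ k.divisors, (μ (l * e) : ℝ) := by
      rw [← sum_filter]
      symm
      refine sum_nbij' (fun e => l * e) (fun d => d / l) ?_ ?_ ?_ ?_ ?_
      · intro e he
        have hek := Nat.dvd_of_mem_divisors he
        simp only [mem_filter, Nat.mem_divisors]
        exact ⟨⟨(mul_dvd_mul_left l hek).trans hmP, hP⟩, dvd_mul_right _ _,
          mul_dvd_mul_left l hek⟩
      · intro d hd
        simp only [mem_filter, Nat.mem_divisors] at hd ⊢
        refine ⟨?_, hk0⟩
        obtain ⟨⟨-, -⟩, ⟨c, rfl⟩, h⟩ := hd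
        rw [Nat.mul_div_cancel_left _ (Nat.pos_of_ne_zero hl0)]
        exact Nat.dvd_of_mul_dvd_mul_left (Nat.pos_of_ne_zero hl0) h
      · intro e _
        exact Nat.mul_div_cancel_left _ (Nat.pos_of_ne_zero hl0)
      · intro d hd
        simp only [mem_filter] at hd
        exact Nat.mul_div_cancel' hd.2.1
      · intros; rfl
    rw [e]
    have e2 : ∑ e ∈ k.divisors, (μ (l * e) : ℝ) = μ l * ((∑ e ∈ k.divisors, μ e : ℤ) : ℝ) := by
      push_cast
      rw [mul_sum]
      refine sum_congr rfl fun e he => ?_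
      rw [isMultiplicative_moebius.map_mul_of_coprime
        (hcop.coprime_dvd_right (Nat.dvd_of_mem_divisors he))]
      push_cast; rfl
    have e3 : (∑ e ∈ k.divisors, μ e : ℤ) = if k = 1 then 1 else 0 := by
      rw [← coe_zeta_mul_apply, coe_zeta_mul_moebius, one_apply]
    rw [e2, e3]
    by_cases hk : k = 1
    · simp [hk]
    · rw [if_neg hk, if_neg]
      · simp
      · intro h
        exact hk (Nat.eq_of_mul_eq_mul_left (Nat.pos_of_ne_zero hl0) (by omega))
  · rw [if_neg (by rintro rfl; exact hlm dvd_rfl)]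
    exact sum_eq_zero fun d _ => if_neg fun h => hlm (h.1.trans h.2)

/-- Möbius inversion: these are the variables in which the quadratic form of the main term is
diagonal. -/
theorem sum_nu_mul_selbergWeight {l : ℕ} (hl : l ∈ s.prodPrimes.divisors) :
    (∑ d ∈ s.prodPrimes.divisors, if l ∣ d then s.nu d * s.selbergWeight R d else 0) =
      if l ≤ R then μ l * s.selbergTerms l / s.selbergMass R else 0 := by
  have h1 : ∀ d ∈ s.prodPrimes.divisors,
      (if l ∣ d then s.nu d * s.selbergWeight R d else 0) =
      ∑ m ∈ s.prodPrimes.divisors with m ≤ R, s.selbergTerms m / s.selbergMass R *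
        if l ∣ d ∧ d ∣ m then (μ d : ℝ) else 0 := by
    intro d hd
    have hdP := Nat.dvd_of_mem_divisors hd
    have hnu := nu_ne_zero hdP
    by_cases hld : l ∣ d
    · rw [if_pos hld, selbergWeight, if_pos hdP]
      rw [mul_div_assoc, ← mul_assoc, mul_comm (μ d : ℝ), ← mul_assoc, mul_inv_cancel₀ hnu, one_mul,
        sum_div, mul_sum]
      refine sum_congr rfl fun m _ => ?_
      by_cases hdm : d ∣ m
      · simp only [hdm, hld, if_true, true_and]; ring
      · simp [hdm]
    · rw [if_neg hld]
      simp [hld]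
  rw [sum_congr rfl h1, sum_comm]
  have h2 : ∀ m ∈ s.prodPrimes.divisors.filter (· ≤ R),
      (∑ d ∈ s.prodPrimes.divisors, s.selbergTerms m / s.selbergMass R *
        if l ∣ d ∧ d ∣ m then (μ d : ℝ) else 0) =
      if l = m then μ l * s.selbergTerms l / s.selbergMass R else 0 := by
    intro m hm
    have hmP := Nat.dvd_of_mem_divisors (mem_filter.1 hm).1
    rw [← mul_sum, sum_moebius_between prodPrimes_ne_zero (squarefree_of_dvd_prodPrimes hmP) hmP]
    split_ifs with h
    · subst h; ring
    · simp
  rw [sum_congr rfl h2, sum_ite_eq]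
  simp only [mem_filter, hl, true_and]

theorem mainSum_selbergWeight (hR : 1 ≤ R) :
    s.mainSum (lambdaSquared (s.selbergWeight R)) = (s.selbergMass R)⁻¹ := by
  have hS := (selbergMass_pos (s := s) hR).ne'
  rw [mainSum_lambdaSquared_eq_sum_mul_sum_sq]
  have h : ∀ l ∈ s.prodPrimes.divisors, (s.selbergTerms l)⁻¹ *
      (∑ d ∈ s.prodPrimes.divisors, if l ∣ d then s.nu d * s.selbergWeight R d else 0) ^ 2 =
      (if l ≤ R then s.selbergTerms l else 0) * ((s.selbergMass R)⁻¹ ^ 2) := by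
    intro l hl
    rw [sum_nu_mul_selbergWeight hl]
    have hlP := Nat.dvd_of_mem_divisors hl
    have hg := (selbergTerms_pos hlP).ne'
    have hmu : (μ l : ℝ) ^ 2 = 1 := by
      have := moebius_sq_eq_one_of_squarefree (squarefree_of_dvd_prodPrimes hlP)
      exact_mod_cast this
    split_ifs
    · field_simp
      rw [hmu]
    · simp
  rw [sum_congr rfl h, ← sum_mul, ← sum_filter]
  change s.selbergMass R * _ = _
  field_simp

theorem abs_lambdaSquared_mul_le {d : ℕ} {e : ℕ → ℝ} {w : ℕ → ℝ} (he : 0 ≤ e d)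
    (hd : d ∣ s.prodPrimes) (hw : ∀ k, R < k → w k = 0) :
    |lambdaSquared w d| * e d ≤ ∑ d1 ∈ s.prodPrimes.divisors with d1 ≤ R,
      ∑ d2 ∈ s.prodPrimes.divisors with d2 ≤ R,
        if d = d1.lcm d2 then |w d1| * |w d2| * e d else 0 := by
  have hsub : d.divisors ⊆ s.prodPrimes.divisors := Nat.divisors_subset_of_dvd prodPrimes_ne_zero hd
  have hnn : ∀ d1 d2, 0 ≤ if d = d1.lcm d2 then |w d1| * |w d2| else 0 := by
    intro d1 d2; split_ifs <;> positivity
  have key : |lambdaSquared w d| ≤ ∑ d1 ∈ s.prodPrimes.divisors with d1 ≤ R,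
      ∑ d2 ∈ s.prodPrimes.divisors with d2 ≤ R,
        if d = d1.lcm d2 then |w d1| * |w d2| else 0 := by
    calc |lambdaSquared w d| ≤ ∑ d1 ∈ d.divisors, ∑ d2 ∈ d.divisors,
          if d = d1.lcm d2 then |w d1| * |w d2| else 0 := by
          unfold lambdaSquared
          refine (abs_sum_le_sum_abs _ _).trans (sum_le_sum fun d1 _ => ?_)
          refine (abs_sum_le_sum_abs _ _).trans (sum_le_sum fun d2 _ => ?_)
          split_ifs <;> simp [abs_mul]
      _ ≤ ∑ d1 ∈ s.prodPrimes.divisors, ∑ d2 ∈ s.prodPrimes.divisors,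
          if d = d1.lcm d2 then |w d1| * |w d2| else 0 := by
          refine (sum_le_sum_of_subset_of_nonneg hsub fun _ _ _ => sum_nonneg fun _ _ => hnn _ _).trans' ?_
          exact sum_le_sum fun d1 _ => sum_le_sum_of_subset_of_nonneg hsub fun _ _ _ => hnn _ _
      _ = _ := by
          rw [sum_filter]
          refine sum_congr rfl fun d1 _ => ?_
          split_ifs with h1
          · rw [sum_filter]
            refine sum_congr rfl fun d2 _ => ?_
            split_ifs with h2 h3 <;> first | rfl | simp [hw d2 (by omega)]
          · exact sum_eq_zero fun d2 _ => by simp [hw d1 (by omega)]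
  refine (mul_le_mul_of_nonneg_right key he).trans_eq ?_
  simp_rw [sum_mul, ite_mul, zero_mul]

/-- There are at most `R ^ 2` pairs `(d1, d2)`; each weight is at most `R`, and the remainder at
most `d1.lcm d2 ≤ R ^ 2`. -/
theorem errSum_selbergWeight_le (hR : 1 ≤ R) (hnu : ∀ d, d ∣ s.prodPrimes → (s.nu d)⁻¹ ≤ d)
    (hrem : ∀ d, d ∣ s.prodPrimes → |s.rem d| ≤ d) :
    s.errSum (lambdaSquared (s.selbergWeight R)) ≤ (R : ℝ) ^ 6 := by
  have hw : ∀ d ∈ s.prodPrimes.divisors.filter (· ≤ R), |s.selbergWeight R d| ≤ R := by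
    intro d hd
    rw [mem_filter, Nat.mem_divisors] at hd
    refine (abs_selbergWeight_le hR hd.1.1).trans ((hnu d hd.1.1).trans ?_)
    exact_mod_cast hd.2
  have hcard : ((s.prodPrimes.divisors.filter (· ≤ R)).card : ℝ) ≤ R := by
    have : s.prodPrimes.divisors.filter (· ≤ R) ⊆ Icc 1 R := by
      intro d hd
      rw [mem_filter] at hd
      exact mem_Icc.2 ⟨Nat.pos_of_mem_divisors hd.1, hd.2⟩
    have := card_le_card this
    rw [Nat.card_Icc, Nat.add_sub_cancel] at this
    exact_mod_cast this
  calc s.errSum (lambdaSquared (s.selbergWeight R))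
      ≤ ∑ d ∈ s.prodPrimes.divisors, ∑ d1 ∈ s.prodPrimes.divisors with d1 ≤ R,
      ∑ d2 ∈ s.prodPrimes.divisors with d2 ≤ R,
        if d = d1.lcm d2 then |s.selbergWeight R d1| * |s.selbergWeight R d2| * |s.rem d| else 0 :=
        sum_le_sum fun d hd => abs_lambdaSquared_mul_le (e := fun d => |s.rem d|) (abs_nonneg _)
          (Nat.dvd_of_mem_divisors hd) fun k hk => selbergWeight_eq_zero_of_lt hk
    _ = ∑ d1 ∈ s.prodPrimes.divisors with d1 ≤ R, ∑ d2 ∈ s.prodPrimes.divisors with d2 ≤ R,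
        ∑ d ∈ s.prodPrimes.divisors,
        if d = d1.lcm d2 then |s.selbergWeight R d1| * |s.selbergWeight R d2| * |s.rem d| else 0 := by
        rw [sum_comm]
        exact sum_congr rfl fun _ _ => sum_comm
    _ ≤ ∑ d1 ∈ s.prodPrimes.divisors with d1 ≤ R, ∑ d2 ∈ s.prodPrimes.divisors with d2 ≤ R,
        (R : ℝ) ^ 4 := by
        refine sum_le_sum fun d1 h1 => sum_le_sum fun d2 h2 => ?_
        have hd1 := (mem_filter.1 h1)
        have hd2 := (mem_filter.1 h2)
        have hlcm : d1.lcm d2 ∣ s.prodPrimes :=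
          Nat.lcm_dvd (Nat.dvd_of_mem_divisors hd1.1) (Nat.dvd_of_mem_divisors hd2.1)
        rw [sum_ite_eq', if_pos (Nat.mem_divisors.2 ⟨hlcm, prodPrimes_ne_zero⟩)]
        have h3 : |s.rem (d1.lcm d2)| ≤ (R : ℝ) ^ 2 := by
          refine (hrem _ hlcm).trans ?_
          have : d1.lcm d2 ≤ d1 * d2 :=
            Nat.le_of_dvd (Nat.mul_pos (Nat.pos_of_mem_divisors hd1.1)
              (Nat.pos_of_mem_divisors hd2.1)) (Nat.lcm_dvd_mul d1 d2)
          have h4 : d1.lcm d2 ≤ R ^ 2 := by nlinarith [hd1.2, hd2.2]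
          exact_mod_cast h4
        calc _ ≤ (R : ℝ) * R * R ^ 2 := by
              gcongr
              · exact hw d1 h1
              · exact hw d2 h2
          _ = _ := by ring
    _ ≤ (R : ℝ) * (R * (R : ℝ) ^ 4) := by
        rw [sum_const, sum_const, nsmul_eq_mul, nsmul_eq_mul]
        gcongr
    _ = _ := by ring

/-- The Selberg upper bound sieve, with a crude error term. -/
theorem siftedSum_le_selberg (hR : 1 ≤ R) (hnu : ∀ d, d ∣ s.prodPrimes → (s.nu d)⁻¹ ≤ d)
    (hrem : ∀ d, d ∣ s.prodPrimes → |s.rem d| ≤ d) :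
    s.siftedSum ≤ s.totalMass / s.selbergMass R + (R : ℝ) ^ 6 := by
  refine (siftedSum_le_mainSum_errSum_of_upperMoebius _
    (upperMoebius_lambdaSquared (s.selbergWeight R) (selbergWeight_one hR))).trans ?_
  rw [mainSum_selbergWeight hR, div_eq_mul_inv]
  gcongr
  exact errSum_selbergWeight_le hR hnu hrem

/-- The Selberg term is `ν(l)` times factors `1 / (1 - ν(p)) ≥ 1`. -/
theorem nu_le_selbergTerms {l : ℕ} (hl : l ∣ s.prodPrimes) : s.nu l ≤ s.selbergTerms l := by
  rw [selbergTerms_apply]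
  refine le_mul_of_one_le_right (nu_pos_of_dvd_prodPrimes hl).le ?_
  refine one_le_prod (fun p hp => ?_)
  have hpp := Nat.prime_of_mem_primeFactors hp
  have hpd := (Nat.dvd_of_mem_primeFactors hp).trans hl
  have h0 := s.nu_pos_of_prime p hpp hpd
  have h1 := s.nu_lt_one_of_prime p hpp hpd
  exact (one_le_inv₀ (by linarith)).2 (by linarith)

end BoundingSieve

/-! ### Lower bound for the sum of `τ(l) / l` over odd squarefree `l` -/

theorem Finset.sum_le_sum_of_mapsTo_of_injOn {ι κ : Type*} {s : Finset ι} {t : Finset κ}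
    {f : ι → ℝ} {g : κ → ℝ} (i : ι → κ) (hi : ∀ x ∈ s, i x ∈ t) (hinj : Set.InjOn i s)
    (hfg : ∀ x ∈ s, f x ≤ g (i x)) (hg : ∀ y ∈ t, 0 ≤ g y) :
    ∑ x ∈ s, f x ≤ ∑ y ∈ t, g y := by
  classical
  calc ∑ x ∈ s, f x ≤ ∑ x ∈ s, g (i x) := sum_le_sum hfg
    _ = ∑ y ∈ s.image i, g y := (sum_image hinj).symm
    _ ≤ ∑ y ∈ t, g y :=
      sum_le_sum_of_subset_of_nonneg (image_subset_iff.2 hi) fun y hy _ => hg y hy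

namespace TwinPairs

open Finset

theorem sum_one_div_sq_le_two (n : ℕ) : ∑ m ∈ Icc 1 n, 1 / (m : ℝ) ^ 2 ≤ 2 := by
  -- The sharper bound telescopes; at `n = 0` it relies on `1 / 0 = 0`.
  suffices h : ∑ m ∈ Icc 1 n, 1 / (m : ℝ) ^ 2 ≤ 2 - 1 / (n : ℝ) from
    h.trans (sub_le_self _ (by positivity))
  induction n with
  | zero => simp
  | succ n ih =>
    rw [sum_Icc_succ_top (by omega)]
    rcases Nat.eq_zero_or_pos n with rfl | hn
    · norm_num
    · have hn' : (0 : ℝ) < n := by exact_mod_cast hn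
      have : 1 / ((n + 1 : ℕ) : ℝ) ^ 2 ≤ 1 / (n : ℝ) - 1 / ((n + 1 : ℕ) : ℝ) := by
        push_cast
        rw [div_sub_div _ _ (by positivity) (by positivity), div_le_div_iff₀ (by positivity) (by positivity)]
        nlinarith
      linarith

/-- The odd squarefree numbers up to `Y`. -/
def oddSquarefree (Y : ℕ) : Finset ℕ := {n ∈ Icc 1 Y | Odd n ∧ Squarefree n}

theorem mem_oddSquarefree {Y n : ℕ} :
    n ∈ oddSquarefree Y ↔ n ≤ Y ∧ Odd n ∧ Squarefree n := by
  simp only [oddSquarefree, mem_filter, mem_Icc]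
  exact ⟨fun h => ⟨h.1.2, h.2⟩, fun h => ⟨⟨h.2.1.pos, h.1⟩, h.2⟩⟩

/-- Factor `n = b ^ 2 * a` with `a` squarefree; the sum over `b` costs a factor of at most 2. -/
theorem sum_odd_le_two_mul_sum_oddSquarefree (Y : ℕ) :
    ∑ n ∈ Icc 1 Y with Odd n, 1 / (n : ℝ) ≤ 2 * ∑ a ∈ oddSquarefree Y, 1 / (a : ℝ) := by
  choose a b hab ha using Nat.sq_mul_squarefree
  calc ∑ n ∈ Icc 1 Y with Odd n, 1 / (n : ℝ)
      ≤ ∑ x ∈ Icc 1 Y ×ˢ oddSquarefree Y, 1 / (x.1 : ℝ) ^ 2 * (1 / (x.2 : ℝ)) := by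
        refine sum_le_sum_of_mapsTo_of_injOn (fun n => (b n, a n)) ?_ ?_ ?_ ?_
        · intro n hn
          obtain ⟨hn, hodd⟩ := mem_filter.1 hn
          obtain ⟨h1, hY⟩ := mem_Icc.1 hn
          have hb : b n ≠ 0 := by
            intro h0
            have := hab n
            rw [h0] at this
            omega
          have hbn : b n ∣ n := Dvd.intro _ (show b n * (b n * a n) = n by rw [← mul_assoc, ← sq, hab])
          have han : a n ∣ n := Dvd.intro_left _ (hab n)
          rw [mem_product, mem_Icc, mem_oddSquarefree]
          exact ⟨⟨Nat.pos_of_ne_zero hb, (Nat.le_of_dvd h1 hbn).trans hY⟩,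
            (Nat.le_of_dvd h1 han).trans hY, hodd.of_dvd_nat han, ha n⟩
        · intro n _ m _ h
          simp only [Prod.mk.injEq] at h
          rw [← hab n, ← hab m, h.1, h.2]
        · intro n _
          conv_lhs => rw [← hab n]
          push_cast
          rw [one_div_mul_one_div]
        · intro x _
          positivity
    _ = (∑ m ∈ Icc 1 Y, 1 / (m : ℝ) ^ 2) * ∑ a ∈ oddSquarefree Y, 1 / (a : ℝ) := by
        rw [sum_mul_sum, sum_product]
    _ ≤ _ := by
        gcongr
        exact sum_one_div_sq_le_two Y

theorem log_le_two_mul_sum_odd (K : ℕ) :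
    Real.log (K + 1) ≤ 2 * ∑ n ∈ Icc 1 (2 * K) with Odd n, 1 / (n : ℝ) := by
  have h := log_add_one_le_harmonic K
  rw [harmonic_eq_sum_Icc] at h
  push_cast at h
  refine h.trans ?_
  rw [mul_sum]
  -- Compare termwise: `1 / k ≤ 2 / (2 * k - 1)`.
  refine sum_le_sum_of_mapsTo_of_injOn (fun k => 2 * k - 1) ?_ ?_ ?_ ?_
  · intro k hk
    rw [mem_Icc] at hk
    rw [mem_filter, mem_Icc]
    exact ⟨by omega, ⟨k - 1, by omega⟩⟩
  · intro k hk l hl h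
    simp only [coe_Icc, Set.mem_Icc] at hk hl h
    omega
  · intro k hk
    rw [mem_Icc] at hk
    have hk' : (1 : ℝ) ≤ k := by exact_mod_cast hk.1
    push_cast [Nat.cast_sub (show 1 ≤ 2 * k by omega)]
    rw [inv_eq_one_div, mul_one_div, div_le_div_iff₀ (by linarith) (by linarith)]
    linarith
  · intro n _
    positivity

/-- With `g = gcd(a, b)` and `l = (a / g) * (b / g)`, one has `a * b = g ^ 2 * l`. The pair is
recovered from `g`, `l` and the divisor `a / g` of `l`, whence the factor `τ(l)`. -/
theorem sq_sum_oddSquarefree_le (Y : ℕ) :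
    (∑ a ∈ oddSquarefree Y, 1 / (a : ℝ)) ^ 2 ≤
      2 * ∑ l ∈ oddSquarefree (Y ^ 2), (l.divisors.card : ℝ) / l := by
  calc (∑ a ∈ oddSquarefree Y, 1 / (a : ℝ)) ^ 2
      = ∑ x ∈ oddSquarefree Y ×ˢ oddSquarefree Y, 1 / (x.1 : ℝ) * (1 / (x.2 : ℝ)) := by
        rw [sq, sum_mul_sum, sum_product]
    _ ≤ ∑ y ∈ Icc 1 Y ×ˢ (oddSquarefree (Y ^ 2)).sigma (fun l => l.divisors),
          1 / (y.1 : ℝ) ^ 2 * (1 / (y.2.1 : ℝ)) := by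
        refine sum_le_sum_of_mapsTo_of_injOn (fun x => (x.1.gcd x.2,
          ⟨(x.1 / x.1.gcd x.2) * (x.2 / x.1.gcd x.2), x.1 / x.1.gcd x.2⟩)) ?_ ?_ ?_ ?_
        · rintro ⟨a, b⟩ hx
          simp only [mem_product, mem_oddSquarefree] at hx
          obtain ⟨⟨haY, hao, has⟩, hbY, hbo, hbs⟩ := hx
          have hg : 0 < a.gcd b := Nat.gcd_pos_of_pos_left _ hao.pos
          have ha' : a / a.gcd b ∣ a := Nat.div_dvd_of_dvd (Nat.gcd_dvd_left a b)
          have hb' : b / a.gcd b ∣ b := Nat.div_dvd_of_dvd (Nat.gcd_dvd_right a b)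
          have hao' := hao.of_dvd_nat ha'
          have hbo' := hbo.of_dvd_nat hb'
          simp only [mem_product, mem_sigma, mem_Icc, mem_oddSquarefree, Nat.mem_divisors]
          refine ⟨⟨hg, (Nat.gcd_le_left _ hao.pos).trans haY⟩, ⟨?_, hao'.mul hbo', ?_⟩,
            dvd_mul_right _ _, (Nat.mul_pos hao'.pos hbo'.pos).ne'⟩
          · rw [sq]
            exact Nat.mul_le_mul ((Nat.div_le_self _ _).trans haY) ((Nat.div_le_self _ _).trans hbY)
          · rw [Nat.squarefree_mul (Nat.coprime_div_gcd_div_gcd hg)]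
            exact ⟨has.squarefree_of_dvd ha', hbs.squarefree_of_dvd hb'⟩
        · rintro ⟨a, b⟩ hx ⟨c, d⟩ hy h
          simp only [coe_product, Set.mem_prod, mem_coe, mem_oddSquarefree] at hx hy
          simp only [Prod.mk.injEq, Sigma.mk.injEq, heq_eq_eq] at h
          obtain ⟨hg, hl, hac⟩ := h
          have h1 : a = c := by
            rw [← Nat.div_mul_cancel (Nat.gcd_dvd_left a b), hac, hg,
              Nat.div_mul_cancel (Nat.gcd_dvd_left c d)]
          have hpos : 0 < a / a.gcd b :=
            Nat.div_pos (Nat.gcd_le_left _ hx.1.2.1.pos) (Nat.gcd_pos_of_pos_left _ hx.1.2.1.pos)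
          rw [← hac] at hl
          have hbd := Nat.eq_of_mul_eq_mul_left hpos hl
          have h2 : b = d := by
            rw [← Nat.div_mul_cancel (Nat.gcd_dvd_right a b), hbd, hg,
              Nat.div_mul_cancel (Nat.gcd_dvd_right c d)]
          rw [h1, h2]
        · rintro ⟨a, b⟩ -
          have h1 := Nat.div_mul_cancel (Nat.gcd_dvd_left a b)
          have h2 := Nat.div_mul_cancel (Nat.gcd_dvd_right a b)
          have h3 : a * b = a.gcd b ^ 2 * (a / a.gcd b * (b / a.gcd b)) := by
            calc a * b = (a / a.gcd b * a.gcd b) * (b / a.gcd b * a.gcd b) := by rw [h1, h2]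
              _ = _ := by ring
          dsimp only
          rw [one_div_mul_one_div, one_div_mul_one_div]
          exact le_of_eq (congrArg _ (by exact_mod_cast h3))
        · intro y _
          positivity
    _ = (∑ m ∈ Icc 1 Y, 1 / (m : ℝ) ^ 2) *
          ∑ l ∈ oddSquarefree (Y ^ 2), (l.divisors.card : ℝ) / l := by
        rw [sum_product, sum_mul]
        refine sum_congr rfl fun m _ => ?_
        rw [sum_sigma, mul_sum]
        refine sum_congr rfl fun l _ => ?_
        dsimp only
        rw [sum_const, nsmul_eq_mul]
        ring
    _ ≤ _ := by
        gcongr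
        exact sum_one_div_sq_le_two Y

theorem log_sq_le_sum_oddSquarefree (K : ℕ) :
    Real.log (K + 1) ^ 2 ≤
      32 * ∑ l ∈ oddSquarefree ((2 * K) ^ 2), (l.divisors.card : ℝ) / l := by
  have h1 := log_le_two_mul_sum_odd K
  have h2 := sum_odd_le_two_mul_sum_oddSquarefree (2 * K)
  have h3 := sq_sum_oddSquarefree_le (2 * K)
  have h0 : 0 ≤ Real.log ((K : ℝ) + 1) := Real.log_nonneg (by simp)
  calc Real.log (K + 1) ^ 2 ≤ (4 * ∑ a ∈ oddSquarefree (2 * K), 1 / (a : ℝ)) ^ 2 := by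
        gcongr
        linarith
    _ ≤ _ := by
        rw [mul_pow]
        linarith

end TwinPairs

/-! ### The sieve of `n * (n + 2)` -/

namespace TwinPairs

open Finset

theorem abs_count_modEq_sub_le {d : ℕ} (hd : 0 < d) (N c : ℕ) :
    |(#{n ∈ range N | n ≡ c [MOD d]} : ℝ) - N / d| ≤ 1 := by
  have hd' : (0 : ℝ) < d := by exact_mod_cast hd
  rw [← Nat.count_eq_card_filter_range, Nat.count_modEq_card N hd]
  have h1 : (N : ℝ) = d * (N / d : ℕ) + (N % d : ℕ) := by exact_mod_cast (Nat.div_add_mod N d).symm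
  have h2 : ((N % d : ℕ) : ℝ) < d := by exact_mod_cast Nat.mod_lt N hd
  have h3 : (0 : ℝ) ≤ (N % d : ℕ) := Nat.cast_nonneg _
  have h4 : (N : ℝ) / d = (N / d : ℕ) + (N % d : ℕ) / d := by
    conv_lhs => rw [h1]
    field_simp
  have h5 : ((N % d : ℕ) : ℝ) / d ≤ 1 := by rw [div_le_one hd']; exact h2.le
  have h6 : (0 : ℝ) ≤ (N % d : ℕ) / d := by positivity
  rw [h4, abs_le]
  split_ifs <;> push_cast <;> constructor <;> linarith

/-- For `d = a * b` the condition means `n ≡ 0` mod `a` and `n ≡ -2` mod `b`: a common divisor of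
`b` and `n` would divide 2, and `b` is odd. -/
theorem exists_gcd_eq_and_dvd_iff_modEq {d a : ℕ} (hd : Odd d) (hsq : Squarefree d) (ha : a ∣ d) :
    ∃ c, ∀ n, (d ∣ n * (n + 2) ∧ d.gcd n = a) ↔ n ≡ c [MOD d] := by
  obtain ⟨b, rfl⟩ := ha
  have hcop : a.Coprime b := Nat.coprime_of_squarefree_mul hsq
  have hb : Odd b := hd.of_dvd_nat (dvd_mul_left _ _)
  -- In `ℕ`, `2 * (b - 1)` represents `-2` mod `b`.
  obtain ⟨c, hca, hcb⟩ := Nat.chineseRemainder hcop 0 (2 * (b - 1))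
  refine ⟨c, fun n => ?_⟩
  rw [← Nat.modEq_and_modEq_iff_modEq_mul hcop]
  have h1 : n ≡ c [MOD a] ↔ a ∣ n :=
    ⟨fun h => (Nat.modEq_zero_iff_dvd).1 (h.trans hca),
      fun h => ((Nat.modEq_zero_iff_dvd).2 h).trans hca.symm⟩
  have h2 : n ≡ c [MOD b] ↔ b ∣ n + 2 := by
    have h3 : 2 * (b - 1) + 2 ≡ 0 [MOD b] := by
      rw [Nat.modEq_zero_iff_dvd]
      exact ⟨2, by have := hb.pos; omega⟩
    constructor
    · intro h
      exact Nat.modEq_zero_iff_dvd.1 (((h.trans hcb).add_right 2).trans h3)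
    · intro h
      exact (Nat.ModEq.add_right_cancel' 2
        ((Nat.modEq_zero_iff_dvd.2 h).trans h3.symm)).trans hcb.symm
  rw [h1, h2]
  constructor
  · rintro ⟨hdvd, hgcd⟩
    refine ⟨hgcd ▸ Nat.gcd_dvd_right _ _, ?_⟩
    have hbn : b.Coprime n := by
      refine Nat.eq_one_of_dvd_coprimes hcop ?_ (Nat.gcd_dvd_left b n)
      rw [← hgcd]
      exact Nat.gcd_dvd_gcd_of_dvd_left _ (dvd_mul_left _ _)
    exact hbn.dvd_of_dvd_mul_left ((dvd_mul_left b a).trans hdvd)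
  · rintro ⟨han, hbn⟩
    refine ⟨mul_dvd_mul han hbn, ?_⟩
    have hbn' : b.Coprime n := by
      have h4 : b.gcd n ∣ 2 := (Nat.dvd_add_right (Nat.gcd_dvd_right b n)).1
        ((Nat.gcd_dvd_left b n).trans hbn)
      exact Nat.eq_one_of_dvd_coprimes (Nat.coprime_two_right.2 hb) (Nat.gcd_dvd_left b n) h4
    rw [Nat.gcd_comm, hcop.gcd_mul n, Nat.gcd_comm n b, hbn'.gcd_eq_one, mul_one,
      Nat.gcd_eq_right han]

/-- Sorting `n` by `d.gcd n` gives one residue class for each divisor of `d`, each with error at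
most 1. -/
theorem abs_card_dvd_mul_add_two_sub_le {d : ℕ} (hd : Odd d) (hsq : Squarefree d) (N : ℕ) :
    |(#{n ∈ range N | d ∣ n * (n + 2)} : ℝ) - (#d.divisors : ℝ) / d * N| ≤ d := by
  have hmaps : ∀ n ∈ {n ∈ range N | d ∣ n * (n + 2)}, d.gcd n ∈ d.divisors := fun n _ =>
    Nat.mem_divisors.2 ⟨Nat.gcd_dvd_left _ _, hd.pos.ne'⟩
  have hfib : ∀ a ∈ d.divisors,
      |(#{n ∈ {n ∈ range N | d ∣ n * (n + 2)} | d.gcd n = a} : ℝ) - N / d| ≤ 1 := by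
    intro a ha
    obtain ⟨c, hc⟩ := exists_gcd_eq_and_dvd_iff_modEq hd hsq (Nat.dvd_of_mem_divisors ha)
    rw [filter_filter, filter_congr (fun n _ => hc n)]
    exact abs_count_modEq_sub_le hd.pos N c
  rw [card_eq_sum_card_fiberwise hmaps]
  have : (#d.divisors : ℝ) / d * N = ∑ a ∈ d.divisors, (N : ℝ) / d := by
    rw [sum_const, nsmul_eq_mul]; ring
  rw [this, Nat.cast_sum, ← sum_sub_distrib]
  calc _ ≤ ∑ a ∈ d.divisors, (1 : ℝ) := (abs_sum_le_sum_abs _ _).trans (sum_le_sum hfib)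
    _ = (#d.divisors : ℝ) := by simp
    _ ≤ d := by exact_mod_cast Nat.card_divisors_le_self d

/-- The product of the odd primes up to `R`. -/
def oddPrimorial (R : ℕ) : ℕ := ∏ p ∈ Icc 3 R with p.Prime, p

theorem squarefree_oddPrimorial (R : ℕ) : Squarefree (oddPrimorial R) := by
  refine squarefree_prod_of_pairwise_isCoprime ?_ fun p hp => (mem_filter.1 hp).2.squarefree
  intro p hp q hq hpq
  exact Nat.coprime_iff_isRelPrime.1
    ((Nat.coprime_primes (mem_filter.1 hp).2 (mem_filter.1 hq).2).2 hpq)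

theorem prime_dvd_oddPrimorial {R p : ℕ} (hp : p.Prime) (h : p ∣ oddPrimorial R) :
    3 ≤ p ∧ p ≤ R := by
  obtain ⟨q, hq, hpq⟩ := (hp.prime.dvd_finsetProd_iff _).1 h
  rw [mem_filter, mem_Icc] at hq
  rw [(Nat.prime_dvd_prime_iff_eq hp hq.2).1 hpq]
  exact hq.1

theorem odd_of_dvd_oddPrimorial {R d : ℕ} (h : d ∣ oddPrimorial R) : Odd d := by
  rw [← Nat.not_even_iff_odd, even_iff_two_dvd]
  intro h2
  have := (prime_dvd_oddPrimorial Nat.prime_two (h2.trans h)).1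
  omega

theorem dvd_oddPrimorial_of_mem_oddSquarefree {R l : ℕ} (hl : l ∈ oddSquarefree R) :
    l ∣ oddPrimorial R := by
  rw [mem_oddSquarefree] at hl
  obtain ⟨hR, ho, hs⟩ := hl
  rw [← Nat.prod_primeFactors_of_squarefree hs]
  refine prod_dvd_prod_of_subset _ _ _ fun p hp => ?_
  have hpp := Nat.prime_of_mem_primeFactors hp
  have hpl := Nat.dvd_of_mem_primeFactors hp
  have hpo := ho.of_dvd_nat hpl
  rw [mem_filter, mem_Icc]
  have h2 := hpp.two_le
  have : p ≠ 2 := by rintro rfl; exact absurd hpo (by decide)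
  exact ⟨⟨by omega, (Nat.le_of_dvd ho.pos hpl).trans hR⟩, hpp⟩

/-- The density `τ(d) / d` of the solutions of `d ∣ n (n + 2)`, for odd squarefree `d`. -/
noncomputable def twinDensity : ArithmeticFunction ℝ :=
  ((ArithmeticFunction.sigma 0 : ArithmeticFunction ℕ) : ArithmeticFunction ℝ).pdiv
    ((ArithmeticFunction.id : ArithmeticFunction ℕ) : ArithmeticFunction ℝ)

theorem twinDensity_apply (d : ℕ) : twinDensity d = (#d.divisors : ℝ) / d := by
  simp [twinDensity, ArithmeticFunction.sigma_zero_apply]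

/-- The sieve of the numbers `n (n + 2)`, `n < N`, by the odd primes up to `R`. -/
noncomputable def twinSieve (N R : ℕ) : BoundingSieve where
  support := (range N).image fun n => n * (n + 2)
  prodPrimes := oddPrimorial R
  prodPrimes_squarefree := squarefree_oddPrimorial R
  weights _ := 1
  weights_nonneg _ := zero_le_one
  totalMass := N
  nu := twinDensity
  nu_mult := ArithmeticFunction.isMultiplicative_sigma.natCast.pdiv
    ArithmeticFunction.isMultiplicative_id.natCast
  nu_pos_of_prime p hp _ := by
    rw [twinDensity_apply, hp.divisors]
    have := hp.pos
    rw [card_pair hp.one_lt.ne]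
    positivity
  -- The density at `p` is `2 / p`, which is why the prime 2 is left out.
  nu_lt_one_of_prime p hp h := by
    have h3 := (prime_dvd_oddPrimorial hp h).1
    have : (3 : ℝ) ≤ p := by exact_mod_cast h3
    rw [twinDensity_apply, hp.divisors, card_pair hp.one_lt.ne, div_lt_one (by linarith)]
    push_cast
    linarith

theorem mul_add_two_injective : Function.Injective fun n : ℕ => n * (n + 2) := by
  intro m n h
  dsimp only at h
  rcases lt_trichotomy m n with h' | h' | h'
  · nlinarith
  · exact h'
  · nlinarith

theorem abs_rem_twinSieve_le {N R d : ℕ} (hd : d ∣ oddPrimorial R) :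
    |(twinSieve N R).rem d| ≤ d := by
  have h := abs_card_dvd_mul_add_two_sub_le (odd_of_dvd_oddPrimorial hd)
    ((squarefree_oddPrimorial R).squarefree_of_dvd hd) N
  convert h using 2
  simp only [BoundingSieve.rem, BoundingSieve.multSum, twinSieve, twinDensity_apply]
  rw [sum_image mul_add_two_injective.injOn, ← sum_filter, sum_const, nsmul_one]

theorem inv_nu_twinSieve_le {N R d : ℕ} (hd : d ∣ oddPrimorial R) :
    ((twinSieve N R).nu d)⁻¹ ≤ d := by
  have h0 := (odd_of_dvd_oddPrimorial hd).pos
  have h1 : (1 : ℝ) ≤ #d.divisors := by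
    exact_mod_cast card_pos.2 (Nat.nonempty_divisors.2 h0.ne')
  change (twinDensity d)⁻¹ ≤ d
  rw [twinDensity_apply, inv_div]
  exact div_le_self (Nat.cast_nonneg _) h1

theorem sum_oddSquarefree_le_selbergMass_twinSieve (N R : ℕ) :
    ∑ l ∈ oddSquarefree R, (#l.divisors : ℝ) / l ≤ (twinSieve N R).selbergMass R := by
  have hP : (twinSieve N R).prodPrimes = oddPrimorial R := rfl
  calc ∑ l ∈ oddSquarefree R, (#l.divisors : ℝ) / l
      ≤ ∑ l ∈ oddSquarefree R, (twinSieve N R).selbergTerms l := by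
        refine sum_le_sum fun l hl => ?_
        rw [← twinDensity_apply]
        exact BoundingSieve.nu_le_selbergTerms (s := twinSieve N R)
          (dvd_oddPrimorial_of_mem_oddSquarefree hl)
    _ ≤ _ := by
        refine sum_le_sum_of_subset_of_nonneg (fun l hl => ?_) fun l hl _ =>
          BoundingSieve.selbergTerms_nonneg_of_mem_divisors (mem_filter.1 hl).1
        rw [mem_filter, Nat.mem_divisors, hP]
        exact ⟨⟨dvd_oddPrimorial_of_mem_oddSquarefree hl, (squarefree_oddPrimorial R).ne_zero⟩,
          (mem_oddSquarefree.1 hl).1⟩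

theorem log_sq_le_selbergMass_twinSieve (N K : ℕ) :
    Real.log (K + 1) ^ 2 ≤
      32 * (twinSieve N ((2 * K) ^ 2)).selbergMass ((2 * K) ^ 2) := by
  refine (log_sq_le_sum_oddSquarefree K).trans ?_
  gcongr
  exact sum_oddSquarefree_le_selbergMass_twinSieve N _

theorem coprime_oddPrimorial {R p : ℕ} (hp : p.Prime) (h : R < p) :
    (oddPrimorial R).Coprime p := by
  rw [Nat.coprime_comm, hp.coprime_iff_not_dvd]
  intro hd
  have := (prime_dvd_oddPrimorial hp hd).2
  omega

theorem card_twins_le_siftedSum (N R : ℕ) :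
    (#{v ∈ range N | R < v ∧ v.Prime ∧ (v + 2).Prime} : ℝ) ≤ (twinSieve N R).siftedSum := by
  change _ ≤ ∑ n ∈ (range N).image fun n => n * (n + 2),
    if (oddPrimorial R).Coprime n then (1 : ℝ) else 0
  rw [sum_image mul_add_two_injective.injOn, ← sum_filter, sum_const, nsmul_one]
  refine Nat.cast_le.2 (card_le_card fun v hv => ?_)
  rw [mem_filter] at hv ⊢
  obtain ⟨hN, hR, hp, hq⟩ := hv
  exact ⟨hN, (coprime_oddPrimorial hp hR).mul_right (coprime_oddPrimorial hq (by omega))⟩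

theorem card_twins_le (N : ℕ) {K : ℕ} (hK : 1 ≤ K) :
    (#{v ∈ range N | (2 * K) ^ 2 < v ∧ v.Prime ∧ (v + 2).Prime} : ℝ) ≤
      32 * N / Real.log (K + 1) ^ 2 + (2 * K : ℝ) ^ 12 := by
  have hR : 1 ≤ (2 * K) ^ 2 := Nat.one_le_pow _ _ (by omega)
  have hlog : 0 < Real.log (K + 1) := Real.log_pos (by
    have : (1 : ℝ) ≤ K := by exact_mod_cast hK
    linarith)
  have hS := BoundingSieve.selbergMass_pos (s := twinSieve N ((2 * K) ^ 2)) hR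
  have hlS := log_sq_le_selbergMass_twinSieve N K
  refine (card_twins_le_siftedSum N _).trans ((BoundingSieve.siftedSum_le_selberg hR
    (fun d hd => inv_nu_twinSieve_le hd) (fun d hd => abs_rem_twinSieve_le hd)).trans ?_)
  refine add_le_add ?_ (le_of_eq (by push_cast; ring))
  change (N : ℝ) / _ ≤ _
  rw [div_le_div_iff₀ hS (by positivity)]
  have hN : (0 : ℝ) ≤ N := Nat.cast_nonneg _
  nlinarith

end TwinPairs

/-! ### Brun's theorem and the six classes -/

namespace TwinPairs

open Finset

/-- The reciprocal of `v` if `v` and `v + 2` are primes, and `0` otherwise. -/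
noncomputable def twinInv (v : ℕ) : ℝ := if v.Prime ∧ (v + 2).Prime then 1 / (v : ℝ) else 0

theorem twinInv_nonneg (v : ℕ) : 0 ≤ twinInv v := by
  unfold twinInv
  split_ifs <;> positivity

theorem sum_twinInv_block_le {m : ℕ} (hm : 1 ≤ m) :
    ∑ v ∈ Ico (2 ^ (16 * m)) (2 ^ (16 * (m + 1))), twinInv v ≤
      2 ^ 23 * (1 / (m : ℝ) ^ 2) + 2 ^ 12 * (1 / 2) ^ m := by
  have hm' : (0 : ℝ) < m := by exact_mod_cast hm
  have hsub : {v ∈ Ico (2 ^ (16 * m)) (2 ^ (16 * (m + 1))) | v.Prime ∧ (v + 2).Prime} ⊆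
      {v ∈ range (2 ^ (16 * (m + 1))) | (2 * 2 ^ m) ^ 2 < v ∧ v.Prime ∧ (v + 2).Prime} := by
    intro v hv
    simp only [mem_filter, mem_Ico, mem_range] at hv ⊢
    refine ⟨hv.1.2, lt_of_lt_of_le ?_ hv.1.1, hv.2⟩
    rw [← pow_succ', ← pow_mul]
    exact Nat.pow_lt_pow_right (by norm_num) (by omega)
  have hcard := (Nat.cast_le (α := ℝ).2 (card_le_card hsub)).trans
    (card_twins_le (2 ^ (16 * (m + 1))) (Nat.one_le_two_pow (n := m)))
  -- Uses `log 2 > 1 / 2`.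
  have hlog : (m : ℝ) / 2 ≤ Real.log (((2 ^ m : ℕ) : ℝ) + 1) := by
    have h1 : Real.log (2 ^ m) ≤ Real.log (((2 ^ m : ℕ) : ℝ) + 1) := by
      apply Real.log_le_log (by positivity)
      push_cast
      linarith
    rw [Real.log_pow] at h1
    have := Real.log_two_gt_d9
    nlinarith
  have hterm : ∑ v ∈ Ico (2 ^ (16 * m)) (2 ^ (16 * (m + 1))), twinInv v ≤
      #{v ∈ Ico (2 ^ (16 * m)) (2 ^ (16 * (m + 1))) | v.Prime ∧ (v + 2).Prime} *
        (1 / (2 : ℝ) ^ (16 * m)) := by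
    simp only [twinInv]
    rw [← sum_filter, ← nsmul_eq_mul]
    refine sum_le_card_nsmul _ _ _ fun v hv => ?_
    have h1 := (mem_Ico.1 (mem_filter.1 hv).1).1
    have h2 : (2 : ℝ) ^ (16 * m) ≤ v := by exact_mod_cast h1
    exact one_div_le_one_div_of_le (by positivity) h2
  refine hterm.trans ((mul_le_mul_of_nonneg_right hcard (by positivity)).trans ?_)
  rw [add_mul]
  refine add_le_add ?_ ?_
  -- The constant is `32 * 2 ^ 16 * 4 = 2 ^ 23`.
  · calc _ ≤ 32 * ((2 ^ (16 * (m + 1)) : ℕ) : ℝ) / ((m : ℝ) / 2) ^ 2 * (1 / 2 ^ (16 * m)) := by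
          gcongr
      _ = _ := by
          push_cast
          rw [mul_add, pow_add]
          field_simp
          norm_num
  · push_cast
    -- The block exponent 16 exceeds 12, so the sieve error decays like `2 ^ (-4 * m)`.
    calc (2 * (2 : ℝ) ^ m) ^ 12 * (1 / 2 ^ (16 * m)) = 2 ^ 12 * ((1 / 2) ^ m) ^ 4 := by
          rw [one_div_pow, mul_pow, pow_mul' 2 16 m]
          field_simp
      _ ≤ 2 ^ 12 * (1 / 2) ^ m := by
          gcongr
          exact pow_le_of_le_one (by positivity) (pow_le_one₀ (by norm_num) (by norm_num))
            (by norm_num)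

/-- **Brun's theorem**. -/
theorem summable_twinInv : Summable twinInv := by
  set b : ℕ → ℝ := fun m => 2 ^ 23 * (1 / (m : ℝ) ^ 2) + 2 ^ 12 * (1 / 2) ^ m with hb
  have hbs : Summable b :=
    ((Real.summable_one_div_nat_pow.2 one_lt_two).mul_left _).add
      (summable_geometric_two.mul_left _)
  have hb0 : ∀ m, 0 ≤ b m := fun m => by positivity
  -- The block estimate needs `m ≥ 1`, so the terms below `2 ^ 16` are kept apart; the extra `b 0`
  -- is nonnegative.
  have hM : ∀ M, ∑ v ∈ range (2 ^ (16 * (M + 1))), twinInv v ≤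
      ∑ v ∈ range (2 ^ 16), twinInv v + ∑ m ∈ range (M + 1), b m := by
    intro M
    induction M with
    | zero =>
      rw [zero_add, mul_one]
      exact le_add_of_nonneg_right (sum_nonneg fun m _ => hb0 m)
    | succ M ih =>
      rw [sum_range_succ b, ← sum_range_add_sum_Ico twinInv
        (show 2 ^ (16 * (M + 1)) ≤ 2 ^ (16 * (M + 1 + 1)) from
          Nat.pow_le_pow_right (by norm_num) (by omega))]
      have := sum_twinInv_block_le (m := M + 1) (by omega)
      change _ ≤ b (M + 1) at this
      linarith
  refine summable_of_sum_range_le (c := ∑ v ∈ range (2 ^ 16), twinInv v + ∑' m, b m)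
    twinInv_nonneg fun n => ?_
  have hn : n ≤ 2 ^ (16 * (n + 1)) :=
    Nat.lt_two_pow_self.le.trans (Nat.pow_le_pow_right (by norm_num) (by omega))
  calc ∑ v ∈ range n, twinInv v ≤ ∑ v ∈ range (2 ^ (16 * (n + 1))), twinInv v :=
        sum_le_sum_of_subset_of_nonneg (range_subset_range.2 hn) fun v _ _ => twinInv_nonneg v
    _ ≤ _ := hM n
    _ ≤ _ := by
        gcongr
        exact hbs.sum_le_tsum _ fun m _ => hb0 m

theorem summable_inv_add_inv_of_subset_twins {T : Set ℕ} (hT : T ⊆ twins) :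
    Summable fun v : T => 1 / (v : ℝ) + 1 / ((v : ℝ) + 2) := by
  refine Summable.of_nonneg_of_le (fun v => by positivity) (fun v => ?_)
    ((summable_twinInv.subtype T).mul_left 2)
  obtain ⟨h5, hp, hq⟩ := hT v.2
  have hpos : (0 : ℝ) < (v : ℕ) := by exact_mod_cast hp.pos
  have h : 1 / ((v : ℝ) + 2) ≤ 1 / (v : ℝ) := one_div_le_one_div_of_le hpos (by linarith)
  simp only [Function.comp_apply, twinInv, hp, hq, and_self, if_true]
  linarith

theorem strongTwins_subset_twins : strongTwins ⊆ twins := fun _ h => h.1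

end TwinPairs

theorem theorem4 :
    Summable (fun v : TwinPairs.twins => (1 / (v : ℝ) + 1 / ((v : ℝ) + 2))) ∧
    Summable (fun v : TwinPairs.twinsU => (1 / (v : ℝ) + 1 / ((v : ℝ) + 2))) ∧
    Summable (fun v : TwinPairs.twinsB => (1 / (v : ℝ) + 1 / ((v : ℝ) + 2))) ∧
    Summable (fun v : TwinPairs.strongTwins => (1 / (v : ℝ) + 1 / ((v : ℝ) + 2))) ∧
    Summable (fun v : TwinPairs.strongTwinsU => (1 / (v : ℝ) + 1 / ((v : ℝ) + 2))) ∧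
    Summable (fun v : TwinPairs.strongTwinsB => (1 / (v : ℝ) + 1 / ((v : ℝ) + 2))) := by
  exact ⟨TwinPairs.summable_inv_add_inv_of_subset_twins subset_rfl,
    TwinPairs.summable_inv_add_inv_of_subset_twins fun _ h => h.1,
    TwinPairs.summable_inv_add_inv_of_subset_twins Set.sdiff_subset,
    TwinPairs.summable_inv_add_inv_of_subset_twins TwinPairs.strongTwins_subset_twins,
    TwinPairs.summable_inv_add_inv_of_subset_twins
      (Set.inter_subset_left.trans TwinPairs.strongTwins_subset_twins),
    TwinPairs.summable_inv_add_inv_of_subset_twins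
      (Set.inter_subset_left.trans TwinPairs.strongTwins_subset_twins)⟩
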